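/- Let $d\ge 3$, $\mu>0$, $l>0$, and let $V(r)=1-\mu r^{-(d-2)}-r^2/l^2$. Suppose that $V$ has at least two distinct positive roots, and let $r_c>r_b>0$ be the two largest. Let $(M,g)$ be the region $r>r_b$ of the $(d+1)$-dimensional positive-mass Schwarzschild–de Sitter spacetime $$ds^2=V(r)\,dt^2-\frac{dr^2}{V(r)}-r^2d\Omega_{d-1}^2,$$ extended across the cosmological horizon $r=r_c$, so that it consists of two static regions $r_b<r<r_c$ on opposite sides of the bifurcation surface of the cosmological horizon, the future and past regions $r>r_c$, and the horizon. Concretely, with $\kappa=-V'(r_c)/2>0$ and $W(r)=(V(r)+2\kappa(r-r_c))/(r-r_c)^2$ (extended smoothly to $r=r_c$), $$M=\{(x,y)\in\mathbb R^2: r_c+xy>r_b\}\times S^{d-1},\qquad r=r_c+xy,$$ $$g=\frac{2}{\kappa}\,dx\,dy+\frac{y^2W(r)}{\kappa^2}\,dx^2-r^2d\Omega_{d-1}^2,$$ where the future is the direction of increasing $x$ along timelike curves, and where $t=\kappa^{-1}\log|x|+\int dr/V(r)$ for $xy\ne0$; the bifurcation surface is $\{x=y=0\}$, and the static regions are $\mathrm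 I=\{x>0,\,y<0\}$ and $\mathrm{II}=\{x<0,\,y>0\}$. A spacetime satisfies the finite version of the Penrose property if for any endless (i.e. without past or future endpoint) smooth timelike curves $\lambda,\nu$ there are $p\in\lambda$ and $q\in\nu$ such that $p$ can be connected to $q$ by a smooth future-pointing timelike curve. Then $(M,g)$ does not satisfy the finite version of the Penrose property. More precisely, there are endless timelike geodesics $\lambda\subset\mathrm I$ and $\nu\subset\mathrm{II}$, both with affine parameter ranging over all of $\mathbb R$, and no point of $\mathrm I$ and point of $\mathrm{II}$ can be connected, in either order, by a future-pointing timelike curve; in particular $\lambda$ and $\nu$ are nowhere timelike connected. -/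

import Mathlib

open Set Filter Topology Manifold ContDiff

noncomputable section

/-! ### Time-oriented Lorentzian manifolds, causality, geodesics -/

/-- A time-oriented Lorentzian metric of signature `(+,-,...,-)` on a smooth manifold `M` without
boundary. Smoothness of `g` is expressed as smoothness of the function `v ↦ g(v,v)` on the tangent
bundle (equivalent by polarization). The time orientation is given by a continuous 1-form that
vanishes on no timelike vector: the future timelike cone at each point is the half of the timelike
vectors on which this form is positive. -/
structure Spacetime {E : Type*} [NormedAddCommGroup E] [NormedSpace ℝ E]
    {H : Type*} [TopologicalSpace H] (I : ModelWithCorners ℝ E H) [I.Boundaryless]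
    (M : Type*) [TopologicalSpace M] [ChartedSpace H M] [IsManifold I ∞ M] where
  /-- the metric tensor -/
  g : ∀ p : M, LinearMap.BilinForm ℝ (TangentSpace I p)
  symm : ∀ p u v, g p u v = g p v u
  lorentzian : ∀ p, ∃ e, 0 < g p e e ∧ ∀ w, g p e w = 0 → w ≠ 0 → g p w w < 0
  smooth : ContMDiff I.tangent 𝓘(ℝ, ℝ) ∞ (fun v : TangentBundle I M => g v.1 v.2 v.2)
  /-- the time orientation -/
  τ : ∀ p : M, TangentSpace I p →ₗ[ℝ] ℝ
  τ_ne_zero : ∀ p v, 0 < g p v v → τ p v ≠ 0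
  τ_continuous : Continuous (fun v : TangentBundle I M => τ v.1 v.2)

namespace Spacetime

variable {E : Type*} [NormedAddCommGroup E] [NormedSpace ℝ E]
  {H : Type*} [TopologicalSpace H] {I : ModelWithCorners ℝ E H} [I.Boundaryless]
  {M : Type*} [TopologicalSpace M] [ChartedSpace H M] [IsManifold I ∞ M]

/-- The velocity at time `t` of a curve `γ` defined on `s ⊆ ℝ`. -/
def velocity (_S : Spacetime I M) (γ : ℝ → M) (s : Set ℝ) (t : ℝ) : TangentSpace I (γ t) :=
  mfderivWithin 𝓘(ℝ, ℝ) I γ s t (1 : ℝ)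

/-- `γ`, restricted to `s`, is a smooth timelike curve. -/
def IsTimelikeCurve (S : Spacetime I M) (γ : ℝ → M) (s : Set ℝ) : Prop :=
  ContMDiffOn 𝓘(ℝ, ℝ) I ∞ γ s ∧
    ∀ t ∈ s, 0 < S.g (γ t) (S.velocity γ s t) (S.velocity γ s t)

/-- `γ`, restricted to `s`, is a smooth future-pointing timelike curve. -/
def IsFutureTimelikeCurve (S : Spacetime I M) (γ : ℝ → M) (s : Set ℝ) : Prop :=
  S.IsTimelikeCurve γ s ∧ ∀ t ∈ s, 0 < S.τ (γ t) (S.velocity γ s t)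

/-- `p` can be connected to `q` by a future-pointing timelike curve. -/
def TimelikePrecedes (S : Spacetime I M) (p q : M) : Prop :=
  ∃ (a b : ℝ) (γ : ℝ → M), a < b ∧ S.IsFutureTimelikeCurve γ (Icc a b) ∧ γ a = p ∧ γ b = q

/-- `γ`, restricted to the non-empty open interval `s`, is an endless timelike curve: it has
neither a limit point of its right end (`atTop` in `s`) nor one of its left end (`atBot` in `s`),
that is, no endpoints in `M`. -/
def IsEndlessTimelikeCurve (S : Spacetime I M) (γ : ℝ → M) (s : Set ℝ) : Prop :=
  s.Nonempty ∧ IsOpen s ∧ s.OrdConnected ∧ S.IsTimelikeCurve γ s ∧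
    (∀ p : M, ¬ Tendsto (fun t : s => γ t) atTop (𝓝 p)) ∧
    (∀ p : M, ¬ Tendsto (fun t : s => γ t) atBot (𝓝 p))

/-- The finite version of the Penrose property: for any endless timelike curves `α`, `β` some
point of `α` can be connected to some point of `β` by a future-pointing timelike curve. -/
def FinitePenroseProperty (S : Spacetime I M) : Prop :=
  ∀ (α β : ℝ → M) (s s' : Set ℝ),
    S.IsEndlessTimelikeCurve α s → S.IsEndlessTimelikeCurve β s' →
      ∃ p ∈ α '' s, ∃ q ∈ β '' s', S.TimelikePrecedes p q

/-- The metric tensor in the extended chart at `p₀`, at the point `z` of the model space. -/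
def chartMetric (S : Spacetime I M) (p₀ : M) (z u v : E) : ℝ :=
  S.g ((extChartAt I p₀).symm z)
    (mfderiv 𝓘(ℝ, E) I (extChartAt I p₀).symm z u)
    (mfderiv 𝓘(ℝ, E) I (extChartAt I p₀).symm z v)

/-- `γ`, restricted to the open set `s`, is an (affinely parametrized) geodesic: `γ` is smooth and
in every chart `x = x(t)` of the atlas it satisfies the geodesic equation, in its Lagrangian form
`d/dt (g_{ij} ẋ^j) = ½ ∂_i g_{jk} ẋ^j ẋ^k`
(contracted with an arbitrary vector `w`). -/
def IsGeodesic (S : Spacetime I M) (γ : ℝ → M) (s : Set ℝ) : Prop :=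
  IsOpen s ∧ ContMDiffOn 𝓘(ℝ, ℝ) I ∞ γ s ∧
    ∀ p₀ : M, ∀ t ∈ s, γ t ∈ (extChartAt I p₀).source → ∀ w : E,
      let x : ℝ → E := fun t' => extChartAt I p₀ (γ t')
      HasDerivAt (fun t' => S.chartMetric p₀ (x t') (deriv x t') w)
        ((1 / 2) * fderiv ℝ (fun z => S.chartMetric p₀ z (deriv x t) (deriv x t)) (x t) w) t

end Spacetime

/-! ### Schwarzschild–de Sitter -/

namespace SdS

/-- The metric function `V(r) = 1 - μ / r^{d-2} - r² / l²` of Schwarzschild–de Sitter spacetime in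
`d + 1` dimensions. -/
def V (d : ℕ) (μ l r : ℝ) : ℝ := 1 - μ / r ^ (d - 2) - r ^ 2 / l ^ 2

/-- Positive-mass Schwarzschild–de Sitter parameters: `V` has at least two distinct positive roots,
the two largest of which are `rb < rc`. -/
structure Params (d : ℕ) (μ l rb rc : ℝ) : Prop where
  three_le : 3 ≤ d
  mass_pos : 0 < μ
  l_pos : 0 < l
  rb_pos : 0 < rb
  rb_lt_rc : rb < rc
  V_rb : V d μ l rb = 0
  V_rc : V d μ l rc = 0
  largest : ∀ r, 0 < r → V d μ l r = 0 → r = rc ∨ r ≤ rb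

/-- The surface gravity `κ = -V'(rc) / 2` of the cosmological horizon. -/
def kappa (d : ℕ) (μ l rc : ℝ) : ℝ := -deriv (V d μ l) rc / 2

/-- The function `W` with `V(r) = V'(rc) (r - rc) + (r - rc)² W(r)` (so `W(rc) = V''(rc) / 2`). -/
def W (d : ℕ) (μ l rc : ℝ) : ℝ → ℝ := dslope (dslope (V d μ l) rc) rc

/-- The domain `{(x, y) | rc + x y > rb}` of the regular coordinates `(x, y)` on the two-dimensional
part of the region `r > rb`; the radius function is `r = rc + x y`. -/
def block (rb rc : ℝ) : TopologicalSpace.Opens (ℝ × ℝ) :=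
  ⟨{z | rb < rc + z.1 * z.2}, isOpen_lt (by fun_prop) (by fun_prop)⟩

/-- The unit sphere `S^{d-1}`. -/
abbrev Sph (d : ℕ) : Type :=
  Metric.sphere (0 : EuclideanSpace ℝ (Fin (d - 1 + 1))) 1

/-- The manifold underlying the region `r > rb` of Schwarzschild–de Sitter. -/
abbrev Mfd (d : ℕ) (rb rc : ℝ) : Type := block rb rc × Sph d

/-- The model with corners of `Mfd`. -/
abbrev model (d : ℕ) : ModelWithCorners ℝ ((ℝ × ℝ) × EuclideanSpace ℝ (Fin (d - 1)))
    (ModelProd (ℝ × ℝ) (EuclideanSpace ℝ (Fin (d - 1)))) :=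
  𝓘(ℝ, ℝ × ℝ).prod (𝓡 (d - 1))

section

variable {d : ℕ} {rb rc : ℝ}

/-- The coordinate `x`. -/
def xc (p : Mfd d rb rc) : ℝ := (p.1 : ℝ × ℝ).1

/-- The coordinate `y`. -/
def yc (p : Mfd d rb rc) : ℝ := (p.1 : ℝ × ℝ).2

/-- The angular position, as a unit vector. -/
def ang (p : Mfd d rb rc) : EuclideanSpace ℝ (Fin (d - 1 + 1)) := p.2

/-- The radius function `r = rc + x y`. -/
def rad (p : Mfd d rb rc) : ℝ := rc + xc p * yc p

/-- The differential `dx`. -/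
def dx (p : Mfd d rb rc) : TangentSpace (model d) p →L[ℝ] ℝ := mvfderiv (model d) xc p

/-- The differential `dy`. -/
def dy (p : Mfd d rb rc) : TangentSpace (model d) p →L[ℝ] ℝ := mvfderiv (model d) yc p

/-- The differential of the angular position. -/
def dang (p : Mfd d rb rc) :
    TangentSpace (model d) p →L[ℝ] EuclideanSpace ℝ (Fin (d - 1 + 1)) :=
  mvfderiv (model d) ang p

/-- The Schwarzschild–de Sitter metric on the region `r > rb`, in coordinates regular across the
cosmological horizon `{x y = 0}`:
`g = (2/κ) dx dy + (y² W(r) / κ²) dx² - r² dΩ²`, with `r = rc + x y`.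

For `x y ≠ 0` put `dt = dx / (κ x) + dr / V(r)`, i.e. `t = log |x| / κ + ∫ dr / V(r)`. Then
this is `V(r) dt² - dr² / V(r) - r² dΩ²`; see `metric_eq_static`. -/
def metric (μ l : ℝ) (p : Mfd d rb rc) : LinearMap.BilinForm ℝ (TangentSpace (model d) p) :=
  LinearMap.mk₂ ℝ
    (fun u v => (1 / kappa d μ l rc) * (dx p u * dy p v + dy p u * dx p v)
      + (yc p ^ 2 * W d μ l rc (rad p) / kappa d μ l rc ^ 2) * (dx p u * dx p v)
      - rad p ^ 2 * inner ℝ (dang p u) (dang p v))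
    (by intro u u' v; simp only [map_add, inner_add_left]; ring)
    (by intro c u v; simp only [map_smul, inner_smul_left, smul_eq_mul]; simp; ring)
    (by intro u v v'; simp only [map_add, inner_add_right]; ring)
    (by intro c u v; simp only [map_smul, inner_smul_right, smul_eq_mul]; ring)


theorem metric_apply (μ l : ℝ) (p : Mfd d rb rc) (u v : TangentSpace (model d) p) :
    metric μ l p u v = (1 / kappa d μ l rc) * (dx p u * dy p v + dy p u * dx p v)
      + (yc p ^ 2 * W d μ l rc (rad p) / kappa d μ l rc ^ 2) * (dx p u * dx p v)
      - rad p ^ 2 * inner ℝ (dang p u) (dang p v) := rfl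

theorem V_eq_W {d : ℕ} {μ l rc : ℝ} (h : V d μ l rc = 0) (r : ℝ) :
    V d μ l r = -2 * kappa d μ l rc * (r - rc) + (r - rc) ^ 2 * W d μ l rc r := by
  have h1 := sub_smul_dslope (V d μ l) rc r
  have h2 := sub_smul_dslope (dslope (V d μ l) rc) rc r
  rw [dslope_same] at h2
  simp only [smul_eq_mul, h] at h1 h2
  simp only [kappa, W]
  linear_combination -h1 - (r - rc) * h2

/-- On `x y ≠ 0`, with `dr = x dy + y dx` and `dt = dx / (κ x) + dr / V(r)`, the metric is
`V dt² - dr² / V - r² dΩ²`. -/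
theorem metric_eq_static {μ l : ℝ} (hV : V d μ l rc = 0) (hk : kappa d μ l rc ≠ 0)
    (p : Mfd d rb rc) (hx : xc p ≠ 0) (hr : V d μ l (rad p) ≠ 0)
    (u : TangentSpace (model d) p) (dr dt : ℝ) (hdr : dr = xc p * dy p u + yc p * dx p u)
    (hdt : dt = dx p u / (kappa d μ l rc * xc p) + dr / V d μ l (rad p)) :
    metric μ l p u u = V d μ l (rad p) * dt ^ 2 - dr ^ 2 / V d μ l (rad p)
      - rad p ^ 2 * ‖dang p u‖ ^ 2 := by
  rw [metric_apply, real_inner_self_eq_norm_sq, hdt]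
  have h1 : V d μ l (rad p) * (dx p u / (kappa d μ l rc * xc p) + dr / V d μ l (rad p)) ^ 2
      - dr ^ 2 / V d μ l (rad p) = V d μ l (rad p) * (dx p u) ^ 2 / (kappa d μ l rc * xc p) ^ 2
        + 2 * dx p u * dr / (kappa d μ l rc * xc p) := by
    field_simp
    ring
  rw [h1, V_eq_W hV (rad p), hdr]
  have : rad p - rc = xc p * yc p := by simp [rad]
  rw [this]
  field_simp
  ring

theorem analyticAt_V (d : ℕ) (μ l : ℝ) {r : ℝ} (hr : 0 < r) :
    AnalyticAt ℝ (V d μ l) r := by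
  unfold V
  have : r ^ (d - 2) ≠ 0 := by positivity
  fun_prop (disch := assumption)

theorem analyticAt_dslope {f : ℝ → ℝ} {c r : ℝ} (hc : AnalyticAt ℝ f c) (hr : AnalyticAt ℝ f r) :
    AnalyticAt ℝ (dslope f c) r := by
  by_cases h : r = c
  · subst h
    obtain ⟨p, hp⟩ := hr
    exact ⟨_, hp.has_fpower_series_dslope_fslope⟩
  · have h1 : AnalyticAt ℝ (fun z => (z - c)⁻¹ * (f z - f c)) r := by
      have : r - c ≠ 0 := sub_ne_zero.2 h
      fun_prop (disch := assumption)
    refine h1.congr ?_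
    filter_upwards [isOpen_ne.mem_nhds h] with z hz
    rw [dslope_of_ne _ hz, slope_def_field]
    field_simp

theorem analyticAt_W (d : ℕ) (μ l : ℝ) {rc r : ℝ} (hc : 0 < rc) (hr : 0 < r) :
    AnalyticAt ℝ (W d μ l rc) r :=
  have h := fun {s : ℝ} (hs : 0 < s) =>
    analyticAt_dslope (analyticAt_V d μ l hc) (analyticAt_V d μ l hs)
  analyticAt_dslope (h hc) (h hr)

theorem Params.kappa_pos {d : ℕ} {μ l rb rc : ℝ} (h : Params d μ l rb rc) :
    0 < kappa d μ l rc := by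
  obtain ⟨n, rfl⟩ : ∃ n, d = n + 3 := ⟨d - 3, by have := h.three_le; omega⟩
  have hrc : 0 < rc := h.rb_pos.trans h.rb_lt_rc
  have hd : deriv (V (n + 3) μ l) rc < 0 := by
    have hconc : StrictConcaveOn ℝ (Ioi 0) (V (n + 3) μ l) := by
      have h1 : StrictConvexOn ℝ (Ioi 0) (fun r : ℝ => r ^ (-(n + 1 : ℤ))) :=
        strictConvexOn_zpow (by omega) (by omega)
      have h2 : ConvexOn ℝ (Ioi 0) (fun r : ℝ => r ^ 2) :=
        (even_two.convexOn_pow).subset (subset_univ _) (convex_Ioi _)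
      refine ⟨convex_Ioi _, fun x hx y hy hxy a b ha hb hab => ?_⟩
      have e1 := h1.2 hx hy hxy ha hb hab
      have e2 := h2.2 hx hy ha.le hb.le hab
      have hV : ∀ r : ℝ, V (n + 3) μ l r = 1 - μ * r ^ (-(n + 1 : ℤ)) - r ^ 2 / l ^ 2 := by
        intro r
        have : n + 3 - 2 = n + 1 := by omega
        rw [V, this, zpow_neg, div_eq_mul_inv]
        norm_cast
      simp only [hV, smul_eq_mul] at e1 e2 ⊢
      have e1' := mul_lt_mul_of_pos_left e1 h.mass_pos
      have e2' := div_le_div_of_nonneg_right e2 (sq_nonneg l)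
      have e3 : (a * x ^ 2 + b * y ^ 2) / l ^ 2 = a * (x ^ 2 / l ^ 2) + b * (y ^ 2 / l ^ 2) := by
        ring
      rw [e3] at e2'
      have e4 : b = 1 - a := by linarith
      subst e4
      nlinarith
    have := hconc.deriv_lt_slope (mem_Ioi.2 h.rb_pos) (mem_Ioi.2 hrc) h.rb_lt_rc
      (analyticAt_V (n + 3) μ l hrc).differentiableAt
    simpa [slope_def_field, h.V_rb, h.V_rc] using this
  unfold kappa
  linarith

theorem rad_pos (hb : 0 < rb) (p : Mfd d rb rc) : 0 < rad p := hb.trans p.1.2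

theorem contMDiff_block : ContMDiff (model d) 𝓘(ℝ, ℝ × ℝ) ∞
    (fun p : Mfd d rb rc => (p.1 : ℝ × ℝ)) :=
  contMDiff_subtype_val.comp contMDiff_fst

theorem contMDiff_xc : ContMDiff (model d) 𝓘(ℝ, ℝ) ∞ (xc : Mfd d rb rc → ℝ) :=
  (contDiff_fst.contMDiff (n := ∞)).comp contMDiff_block

theorem contMDiff_yc : ContMDiff (model d) 𝓘(ℝ, ℝ) ∞ (yc : Mfd d rb rc → ℝ) :=
  (contDiff_snd.contMDiff (n := ∞)).comp contMDiff_block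

theorem contMDiff_rad : ContMDiff (model d) 𝓘(ℝ, ℝ) ∞ (rad : Mfd d rb rc → ℝ) := by
  have hF : ContDiff ℝ ∞ (fun z : ℝ × ℝ => rc + z.1 * z.2) := by fun_prop
  exact hF.contMDiff.comp contMDiff_block

theorem fact_finrank (d : ℕ) :
    Fact (Module.finrank ℝ (EuclideanSpace ℝ (Fin (d - 1 + 1))) = d - 1 + 1) := ⟨by simp⟩

theorem contMDiff_ang : ContMDiff (model d) 𝓘(ℝ, EuclideanSpace ℝ (Fin (d - 1 + 1))) ∞
    (ang : Mfd d rb rc → _) :=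
  have := fact_finrank d
  (contMDiff_coe_sphere (n := d - 1)).comp contMDiff_snd

theorem hasMFDerivAt_val (z : block rb rc) :
    HasMFDerivAt 𝓘(ℝ, ℝ × ℝ) 𝓘(ℝ, ℝ × ℝ) (Subtype.val : block rb rc → ℝ × ℝ) z
      (ContinuousLinearMap.id ℝ (ℝ × ℝ)) := by
  refine ⟨continuous_subtype_val.continuousAt, ?_⟩
  simp only [mfld_simps]
  refine (hasFDerivAt_id _).congr_of_eventuallyEq ?_ |>.hasFDerivWithinAt
  have : ((block rb rc : TopologicalSpace.Opens (ℝ × ℝ)) : Set (ℝ × ℝ)) ∈ 𝓝 (z : ℝ × ℝ) :=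
    (block rb rc).isOpen.mem_nhds z.2
  filter_upwards [this] with w hw
  have := OpenPartialHomeomorph.right_inv (((chartAt (ℝ × ℝ) (z : ℝ × ℝ)).subtypeRestr ⟨z⟩)) (x := w)
    (by simpa [OpenPartialHomeomorph.subtypeRestr, chartAt_self_eq] using hw)
  simpa [TopologicalSpace.Opens.chartAt_eq] using this

theorem dblock_apply (p : Mfd d rb rc) (v : TangentSpace (model d) p) :
    mvfderiv (model d) (fun p : Mfd d rb rc => (p.1 : ℝ × ℝ)) p v = v.1 := by
  have h := (hasMFDerivAt_val p.1).comp p (hasMFDerivAt_fst (I := 𝓘(ℝ, ℝ × ℝ)) (I' := 𝓡 (d - 1)) p)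
  exact congrArg (fun L => L v) h.mfderiv

theorem contMDiff_mvfderiv {E : Type*} [NormedAddCommGroup E] [NormedSpace ℝ E]
    {H : Type*} [TopologicalSpace H] {I : ModelWithCorners ℝ E H}
    {M : Type*} [TopologicalSpace M] [ChartedSpace H M] [IsManifold I ∞ M]
    {F : Type*} [NormedAddCommGroup F] [NormedSpace ℝ F] {f : M → F}
    (hf : ContMDiff I 𝓘(ℝ, F) ∞ f) :
    ContMDiff I.tangent 𝓘(ℝ, F) ∞ (fun v : TangentBundle I M => mvfderiv I f v.1 v.2) := by
  have h1 := hf.contMDiff_tangentMap (m := ∞) (by simp)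
  have h2 := contMDiff_tangentBundleModelSpaceHomeomorph (I := 𝓘(ℝ, F)) (n := ∞)
  have h3 : ContMDiff 𝓘(ℝ, F).tangent 𝓘(ℝ, F) ∞
      (fun v : TangentBundle 𝓘(ℝ, F) F => (v.2 : F)) := by
    have h : ContMDiff 𝓘(ℝ, F).tangent 𝓘(ℝ, F × F) ∞
        (fun v : TangentBundle 𝓘(ℝ, F) F => ((v.1, v.2) : F × F)) := by
      rw [← modelWithCornersSelf_prod] at h2
      exact h2
    exact (contDiff_snd (𝕜 := ℝ) (E := F) (F := F)).contMDiff.comp h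
  exact h3.comp h1

theorem dx_apply (p : Mfd d rb rc) (v : TangentSpace (model d) p) : dx p v = v.1.1 := by
  have h : HasMFDerivAt 𝓘(ℝ, ℝ × ℝ) 𝓘(ℝ, ℝ) (Prod.fst : ℝ × ℝ → ℝ) (p.1 : ℝ × ℝ)
    (ContinuousLinearMap.fst ℝ ℝ ℝ) := (hasFDerivAt_fst).hasMFDerivAt
  have h := h.comp p ((hasMFDerivAt_val p.1).comp p
    (hasMFDerivAt_fst (I := 𝓘(ℝ, ℝ × ℝ)) (I' := 𝓡 (d - 1)) p))
  exact congrArg (fun L => L v) h.mfderiv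

theorem dy_apply (p : Mfd d rb rc) (v : TangentSpace (model d) p) : dy p v = v.1.2 := by
  have h : HasMFDerivAt 𝓘(ℝ, ℝ × ℝ) 𝓘(ℝ, ℝ) (Prod.snd : ℝ × ℝ → ℝ) (p.1 : ℝ × ℝ)
    (ContinuousLinearMap.snd ℝ ℝ ℝ) := (hasFDerivAt_snd).hasMFDerivAt
  have h := h.comp p ((hasMFDerivAt_val p.1).comp p
    (hasMFDerivAt_fst (I := 𝓘(ℝ, ℝ × ℝ)) (I' := 𝓡 (d - 1)) p))
  exact congrArg (fun L => L v) h.mfderiv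

theorem dang_apply (p : Mfd d rb rc) (v : TangentSpace (model d) p) :
    dang p v = mvfderiv (𝓡 (d - 1))
      ((↑) : Sph d → EuclideanSpace ℝ (Fin (d - 1 + 1))) p.2 v.2 := by
  have := fact_finrank d
  have h := ((contMDiff_coe_sphere (n := d - 1) (m := ∞)
    (E := EuclideanSpace ℝ (Fin (d - 1 + 1))) p.2).mdifferentiableAt (by simp)).hasMFDerivAt.comp p
    (hasMFDerivAt_snd (I := 𝓘(ℝ, ℝ × ℝ)) (I' := 𝓡 (d - 1)) p)
  exact congrArg (fun L => L v) h.mfderiv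

theorem contMDiff_dx : ContMDiff (model d).tangent 𝓘(ℝ, ℝ) ∞
    (fun v : TangentBundle (model d) (Mfd d rb rc) => dx v.1 v.2) :=
  contMDiff_mvfderiv contMDiff_xc

/-- The region `r > rb` of positive-mass Schwarzschild–de Sitter spacetime in `d + 1` dimensions.
The form `dx` vanishes on no timelike vector; the future is the direction of increasing `x`, so
that the radius increases to the future in `{x > 0, y > 0}` and decreases in `{x < 0, y < 0}`. -/
def spacetime {μ l : ℝ} (h : Params d μ l rb rc) : Spacetime (model d) (Mfd d rb rc) where
  g := metric μ l
  symm p u v := by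
    simp only [metric_apply, real_inner_comm]
    ring
  lorentzian p := by
    have hk := h.kappa_pos
    have hr := rad_pos h.rb_pos p
    set k := kappa d μ l rc with hkdef
    set A := yc p ^ 2 * W d μ l rc (rad p) / k ^ 2 with hA
    have key : ∀ u v, metric μ l p u v = (1 / k) * (dx p u * dy p v + dy p u * dx p v)
      + A * (dx p u * dx p v) - rad p ^ 2 * inner ℝ (dang p u) (dang p v) := metric_apply μ l p
    obtain ⟨e, e1, e2, e3⟩ : ∃ e : TangentSpace (model d) p,
        dx p e = 1 ∧ dy p e = k * (1 - A) / 2 ∧ dang p e = 0 := by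
      refine ⟨(((1 : ℝ), k * (1 - A) / 2), (0 : EuclideanSpace ℝ (Fin (d - 1)))),
        dx_apply _ _, dy_apply _ _, (dang_apply _ _).trans (map_zero _)⟩
    refine ⟨e, ?_, fun w h0 hw => ?_⟩
    · rw [key, e1, e2, e3, inner_zero_left]
      field_simp
      linarith
    · rw [key, e1, e2, e3, inner_zero_left] at h0
      have h1 : dy p w = -k * (1 + A) / 2 * dx p w := by
        field_simp at h0
        linear_combination h0 / 2
      rw [key, real_inner_self_eq_norm_sq, h1]
      have h2 : (1 / k) * (dx p w * (-k * (1 + A) / 2 * dx p w)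
          + -k * (1 + A) / 2 * dx p w * dx p w) + A * (dx p w * dx p w)
          - rad p ^ 2 * ‖dang p w‖ ^ 2 = - (dx p w ^ 2 + (rad p * ‖dang p w‖) ^ 2) := by
        field_simp
        ring
      rw [h2, neg_lt_zero]
      by_contra hcon
      have h3 : dx p w = 0 := by
        by_contra hne
        have := pow_pos (abs_pos.2 hne) 2
        rw [sq_abs] at this
        nlinarith [sq_nonneg (rad p * ‖dang p w‖)]
      have h4 : dang p w = 0 := by
        by_contra hne
        have : 0 < (rad p * ‖dang p w‖) ^ 2 := by
          have := norm_pos_iff.2 hne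
          positivity
        nlinarith [sq_nonneg (dx p w)]
      rw [h3, mul_zero] at h1
      rw [dx_apply] at h3
      rw [dy_apply] at h1
      rw [dang_apply] at h4
      have := fact_finrank d
      have h5 := injective_mvfderiv_subtypeVal_sphere (n := d - 1) p.2 (h4.trans (map_zero _).symm)
      exact hw (Prod.ext (Prod.ext h3 h1) h5)
  smooth := by
    have h1 := contMDiff_dx (d := d) (rb := rb) (rc := rc)
    have h2 : ContMDiff (model d).tangent 𝓘(ℝ, ℝ) ∞
      (fun v : TangentBundle (model d) (Mfd d rb rc) => dy v.1 v.2) :=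
      contMDiff_mvfderiv contMDiff_yc
    have h3 : ContMDiff (model d).tangent 𝓘(ℝ, EuclideanSpace ℝ (Fin (d - 1 + 1))) ∞
      (fun v : TangentBundle (model d) (Mfd d rb rc) => dang v.1 v.2) :=
      contMDiff_mvfderiv contMDiff_ang
    have hW : ContMDiff (model d) 𝓘(ℝ, ℝ) ∞
        (fun p : Mfd d rb rc => W d μ l rc (rad p)) := fun p =>
      (analyticAt_W d μ l (h.rb_pos.trans h.rb_lt_rc)
        (rad_pos h.rb_pos p)).contDiffAt.contMDiffAt.comp p (contMDiff_rad p)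
    have hpr : ContMDiff (model d).tangent (model d) ∞
        (fun v : TangentBundle (model d) (Mfd d rb rc) => v.1) :=
      Bundle.contMDiff_proj (TangentSpace (model d))
    have hy := contMDiff_yc.comp hpr
    have hr := contMDiff_rad.comp hpr
    have hW := hW.comp hpr
    have hF : ContDiff ℝ ∞ (fun z : ℝ × ℝ × ℝ × ℝ × ℝ × EuclideanSpace ℝ (Fin (d - 1 + 1)) =>
        (1 / kappa d μ l rc) * (z.1 * z.2.1 + z.2.1 * z.1)
        + (z.2.2.1 ^ 2 * z.2.2.2.1 / kappa d μ l rc ^ 2) * (z.1 * z.1)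
        - z.2.2.2.2.1 ^ 2 * inner ℝ z.2.2.2.2.2 z.2.2.2.2.2) := by
      have hi : ContDiff ℝ ∞
          (fun z : ℝ × ℝ × ℝ × ℝ × ℝ × EuclideanSpace ℝ (Fin (d - 1 + 1)) =>
          (inner ℝ z.2.2.2.2.2 z.2.2.2.2.2 : ℝ)) :=
        ContDiff.inner ℝ (by fun_prop) (by fun_prop)
      fun_prop
    exact hF.contMDiff.comp (h1.prodMk_space (h2.prodMk_space (hy.prodMk_space
      (hW.prodMk_space (hr.prodMk_space h3)))))
  τ p := dx p
  τ_ne_zero p v hv := by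
    intro h0
    have h0' : dx p v = 0 := h0
    rw [metric_apply, h0'] at hv
    have := real_inner_self_nonneg (x := dang p v)
    have := mul_nonneg (sq_nonneg (rad p)) this
    linarith
  τ_continuous := contMDiff_dx.continuous

/-- The static region `rb < r < rc` on one side of the bifurcation surface `{x = y = 0}`. -/
def staticI (d : ℕ) (rb rc : ℝ) : Set (Mfd d rb rc) := {p | 0 < xc p ∧ yc p < 0}

/-- The static region `rb < r < rc` on the opposite side of the bifurcation surface. -/
def staticII (d : ℕ) (rb rc : ℝ) : Set (Mfd d rb rc) := {p | xc p < 0 ∧ 0 < yc p}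

end

end SdS

/-! Causal separation comes from two one-way barriers. The time orientation is `dx`, so `x`
increases along future-pointing timelike curves, and `x ≥ 0` is never left. The `dx²` coefficient of
the metric carries a factor `y²` and the angular part is nonpositive; hence at `y = 0` a timelike
vector with `dx > 0` has `dy > 0`, and `y ≥ 0` is never left either. The first barrier forbids going
from I to II, the second from II to I (`xc_nonneg_of_timelikePrecedes`,
`yc_nonneg_of_timelikePrecedes`).

The endless geodesics are static observers. `V` vanishes at both horizons and `V'(rc) < 0`, so its
maximum between them is positive and critical (`Params.exists_deriv_V_eq_zero`). At that radius `rc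
- a` the curves `x = σ e^t`, `y = -σ a e^{-t}` with fixed angle are timelike because `V > 0`
(`isTimelikeCurve_staticWorldline`) and geodesic because `V' = 0` (`isGeodesic_staticWorldline`).
One coordinate blows up at each end, so there are no endpoints. The signs `σ = 1` and `σ = -1` give
the two static regions; such a pair refutes the finite Penrose property. -/

/-! ### Barrier argument and chain rules on manifolds -/

section Calculus

variable {E : Type*} [NormedAddCommGroup E] [NormedSpace ℝ E]
  {H : Type*} [TopologicalSpace H] {I : ModelWithCorners ℝ E H}
  {M : Type*} [TopologicalSpace M] [ChartedSpace H M]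
  {F : Type*} [NormedAddCommGroup F] [NormedSpace ℝ F]

/-- A function that starts nonnegative and has positive derivative at each of its zeros stays
nonnegative. -/
theorem nonneg_of_hasDerivWithinAt_pos_of_eq_zero {f f' : ℝ → ℝ} {a b : ℝ} (hab : a ≤ b)
    (hf : ∀ t ∈ Icc a b, HasDerivWithinAt f (f' t) (Icc a b) t)
    (hpos : ∀ t ∈ Icc a b, f t = 0 → 0 < f' t) (ha : 0 ≤ f a) : 0 ≤ f b := by
  -- Fencing lemma for `-f` below the constant barrier `0`: derivatives are compared only where the
  -- two touch.
  have h := image_le_of_deriv_right_lt_deriv_boundary' (f := fun t => -f t) (f' := fun t => -f' t)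
    (a := a) (b := b) (B := fun _ => 0) (B' := fun _ => 0)
    (fun t ht => (hf t ht).neg.continuousWithinAt)
    (fun t ht => ((hf t (Ico_subset_Icc_self ht)).neg).mono_of_mem_nhdsWithin
      (Icc_mem_nhdsGE_of_mem ht))
    (by simpa using ha) continuousOn_const (fun t _ => hasDerivWithinAt_const t _ _)
    (fun t ht h0 => by
      have := hpos t (Ico_subset_Icc_self ht) (by simpa using h0)
      linarith)
  simpa using h (right_mem_Icc.2 hab)

theorem hasDerivWithinAt_comp_mvfderiv {f : M → F} {γ : ℝ → M} {s : Set ℝ} {t : ℝ}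
    (hf : MDifferentiableAt I 𝓘(ℝ, F) f (γ t)) (hγ : MDifferentiableWithinAt 𝓘(ℝ, ℝ) I γ s t) :
    HasDerivWithinAt (f ∘ γ)
      (mvfderiv I f (γ t) (mfderivWithin 𝓘(ℝ, ℝ) I γ s t (1 : ℝ))) s t := by
  have h := hf.hasMFDerivAt.comp_hasMFDerivWithinAt t hγ.hasMFDerivWithinAt
  have h' : HasFDerivWithinAt (f ∘ γ) ((mvfderiv I f (γ t)).comp
      (mfderivWithin 𝓘(ℝ, ℝ) I γ s t : ℝ →L[ℝ] TangentSpace I (γ t))) s t := h.hasFDerivWithinAt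
  exact h'.hasDerivWithinAt

/-- The chain rule for `f` composed with the inverse chart, with `G` the coordinate expression of
`f`. It makes `dx`, `dy` and `dang` explicit on chart vectors. -/
theorem mvfderiv_mfderiv_extChartAt_symm [I.Boundaryless] [IsManifold I ∞ M] {p₀ : M} {f : M → F}
    {G : E → F} {z : E} (hz : z ∈ (extChartAt I p₀).target) (hf : MDifferentiable I 𝓘(ℝ, F) f)
    (hG : ∀ w ∈ (extChartAt I p₀).target, f ((extChartAt I p₀).symm w) = G w) (u : E) :
    mvfderiv I f ((extChartAt I p₀).symm z) (mfderiv 𝓘(ℝ, E) I (extChartAt I p₀).symm z u)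
      = fderiv ℝ G z u := by
  have hn : (extChartAt I p₀).target ∈ 𝓝 z := (isOpen_extChartAt_target p₀).mem_nhds hz
  have hs : MDifferentiableAt 𝓘(ℝ, E) I (extChartAt I p₀).symm z :=
    ((contMDiffOn_extChartAt_symm (n := ∞) p₀).contMDiffAt hn).mdifferentiableAt (by simp)
  obtain ⟨L, hL, hLu⟩ : ∃ L : E →L[ℝ] F, HasFDerivAt (f ∘ (extChartAt I p₀).symm) L z ∧
      mvfderiv I f ((extChartAt I p₀).symm z) (mfderiv 𝓘(ℝ, E) I (extChartAt I p₀).symm z u)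
        = L u :=
    ⟨_, ((hf _).hasMFDerivAt.comp z hs.hasMFDerivAt).hasFDerivAt, rfl⟩
  have hG' : G =ᶠ[𝓝 z] f ∘ (extChartAt I p₀).symm := by
    filter_upwards [hn] with w hw using (hG w hw).symm
  rw [(hL.congr_of_eventuallyEq hG').fderiv, hLu]

end Calculus

/-! ### The metric in charts -/

namespace SdS

variable {d : ℕ} {μ l rb rc : ℝ}

theorem extChartAt_block_symm_coe (z₀ : block rb rc) {w : ℝ × ℝ}
    (hw : w ∈ (extChartAt 𝓘(ℝ, ℝ × ℝ) z₀).target) :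
    ((extChartAt 𝓘(ℝ, ℝ × ℝ) z₀).symm w : ℝ × ℝ) = w := by
  -- The chart of the open set `block` is the inclusion, so `right_inv` is the claim by definition.
  have h := (extChartAt 𝓘(ℝ, ℝ × ℝ) z₀).right_inv hw
  exact h

theorem extChartAt_symm_fst (p₀ : Mfd d rb rc) {z : (ℝ × ℝ) × EuclideanSpace ℝ (Fin (d - 1))}
    (hz : z ∈ (extChartAt (model d) p₀).target) :
    (((extChartAt (model d) p₀).symm z).1 : ℝ × ℝ) = z.1 := by
  rw [extChartAt_prod] at hz ⊢
  exact extChartAt_block_symm_coe p₀.1 hz.1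

variable (p₀ : Mfd d rb rc) {z : (ℝ × ℝ) × EuclideanSpace ℝ (Fin (d - 1))}

theorem dx_extChartAt_symm (hz : z ∈ (extChartAt (model d) p₀).target)
    (u : (ℝ × ℝ) × EuclideanSpace ℝ (Fin (d - 1))) :
    dx ((extChartAt (model d) p₀).symm z)
      (mfderiv 𝓘(ℝ, (ℝ × ℝ) × EuclideanSpace ℝ (Fin (d - 1))) (model d)
        (extChartAt (model d) p₀).symm z u) = u.1.1 := by
  refine (mvfderiv_mfderiv_extChartAt_symm (G := ⇑((ContinuousLinearMap.fst ℝ ℝ ℝ).comp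
    (ContinuousLinearMap.fst ℝ (ℝ × ℝ) (EuclideanSpace ℝ (Fin (d - 1)))))) hz
    (contMDiff_xc.mdifferentiable (by simp))
    (fun w hw => ?_) u).trans ?_
  · exact congrArg Prod.fst (extChartAt_symm_fst p₀ hw)
  rw [ContinuousLinearMap.fderiv]
  rfl

theorem dy_extChartAt_symm (hz : z ∈ (extChartAt (model d) p₀).target)
    (u : (ℝ × ℝ) × EuclideanSpace ℝ (Fin (d - 1))) :
    dy ((extChartAt (model d) p₀).symm z)
      (mfderiv 𝓘(ℝ, (ℝ × ℝ) × EuclideanSpace ℝ (Fin (d - 1))) (model d)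
        (extChartAt (model d) p₀).symm z u) = u.1.2 := by
  refine (mvfderiv_mfderiv_extChartAt_symm (G := ⇑((ContinuousLinearMap.snd ℝ ℝ ℝ).comp
    (ContinuousLinearMap.fst ℝ (ℝ × ℝ) (EuclideanSpace ℝ (Fin (d - 1)))))) hz
    (contMDiff_yc.mdifferentiable (by simp))
    (fun w hw => ?_) u).trans ?_
  · exact congrArg Prod.snd (extChartAt_symm_fst p₀ hw)
  rw [ContinuousLinearMap.fderiv]
  rfl

theorem dang_extChartAt_symm (hz : z ∈ (extChartAt (model d) p₀).target)
    (u : (ℝ × ℝ) × EuclideanSpace ℝ (Fin (d - 1))) (hu : u.2 = 0) :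
    dang ((extChartAt (model d) p₀).symm z)
      (mfderiv 𝓘(ℝ, (ℝ × ℝ) × EuclideanSpace ℝ (Fin (d - 1))) (model d)
        (extChartAt (model d) p₀).symm z u) = 0 := by
  set A : EuclideanSpace ℝ (Fin (d - 1)) → EuclideanSpace ℝ (Fin (d - 1 + 1)) :=
    fun a => ((extChartAt (𝓡 (d - 1)) p₀.2).symm a : Sph d) with hA
  have hz2 : z.2 ∈ (extChartAt (𝓡 (d - 1)) p₀.2).target := by
    rw [extChartAt_prod] at hz
    exact hz.2
  have := fact_finrank d
  have hs : MDifferentiableAt (𝓡 (d - 1)) (𝓡 (d - 1)) (extChartAt (𝓡 (d - 1)) p₀.2).symm z.2 :=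
    ((contMDiffOn_extChartAt_symm (n := ∞) p₀.2).contMDiffAt
      ((isOpen_extChartAt_target p₀.2).mem_nhds hz2)).mdifferentiableAt (by simp)
  have hAd : DifferentiableAt ℝ A z.2 :=
    (((contMDiff_coe_sphere (n := d - 1) (m := ∞)
      (E := EuclideanSpace ℝ (Fin (d - 1 + 1))) _).mdifferentiableAt (by simp)).comp z.2
        hs).differentiableAt
  -- In the product chart the angular position depends on the second component alone, so its
  -- derivative kills vectors with `u.2 = 0`.
  refine (mvfderiv_mfderiv_extChartAt_symm (G := A ∘ Prod.snd) hz
    (contMDiff_ang.mdifferentiable (by simp)) (fun w _ => ?_) u).trans ?_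
  · rw [extChartAt_prod]
    rfl
  · rw [(hAd.hasFDerivAt.comp z hasFDerivAt_snd).fderiv]
    simp [hu]

/-- The metric in a chart, applied to a vector without angular component. -/
theorem chartMetric_of_snd_eq_zero (h : Params d μ l rb rc)
    (hz : z ∈ (extChartAt (model d) p₀).target)
    (u v : (ℝ × ℝ) × EuclideanSpace ℝ (Fin (d - 1))) (hu : u.2 = 0) :
    (spacetime h).chartMetric p₀ z u v =
      (1 / kappa d μ l rc) * (u.1.1 * v.1.2 + u.1.2 * v.1.1)
      + (z.1.2 ^ 2 * W d μ l rc (rc + z.1.1 * z.1.2) / kappa d μ l rc ^ 2) * (u.1.1 * v.1.1) := by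
  refine (metric_apply μ l _ _ _).trans ?_
  -- One vanishing argument already removes the angular inner product; `v` stays arbitrary, as the
  -- test vector of the geodesic equation must.
  rw [dx_extChartAt_symm p₀ hz, dx_extChartAt_symm p₀ hz, dy_extChartAt_symm p₀ hz,
    dy_extChartAt_symm p₀ hz, dang_extChartAt_symm p₀ hz u hu, inner_zero_left]
  simp only [rad, xc, yc, extChartAt_symm_fst p₀ hz]
  ring

end SdS

namespace SdS

variable {d : ℕ} {μ l rb rc : ℝ}

/-! ### Causal barriers at the horizon -/

section Causality

variable (h : Params d μ l rb rc) {γ : ℝ → Mfd d rb rc} {s : Set ℝ}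

theorem hasDerivWithinAt_xc (hγ : (spacetime h).IsTimelikeCurve γ s) {t : ℝ} (ht : t ∈ s) :
    HasDerivWithinAt (fun t => xc (γ t)) (dx (γ t) ((spacetime h).velocity γ s t)) s t :=
  hasDerivWithinAt_comp_mvfderiv ((contMDiff_xc _).mdifferentiableAt (by simp))
    ((hγ.1 t ht).mdifferentiableWithinAt (by simp))

theorem hasDerivWithinAt_yc (hγ : (spacetime h).IsTimelikeCurve γ s) {t : ℝ} (ht : t ∈ s) :
    HasDerivWithinAt (fun t => yc (γ t)) (dy (γ t) ((spacetime h).velocity γ s t)) s t :=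
  hasDerivWithinAt_comp_mvfderiv ((contMDiff_yc _).mdifferentiableAt (by simp))
    ((hγ.1 t ht).mdifferentiableWithinAt (by simp))

/-- On the horizon `y = 0`, `y` increases along future-pointing timelike vectors. -/
theorem dy_pos_of_yc_eq_zero {p : Mfd d rb rc} {v : TangentSpace (model d) p}
    (hv : 0 < (spacetime h).g p v v) (hx : 0 < dx p v) (hy : yc p = 0) : 0 < dy p v := by
  have hk := h.kappa_pos
  replace hv : 0 < metric μ l p v v := hv
  rw [metric_apply, hy] at hv
  have h1 : 0 ≤ rad p ^ 2 * inner ℝ (dang p v) (dang p v) :=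
    mul_nonneg (sq_nonneg _) real_inner_self_nonneg
  -- With `y = 0` the `dx²` term is gone and the angular term can only lower `g(v,v)`, so the cross
  -- term is positive.
  have h2 : 0 < (1 / kappa d μ l rc) * (2 * dx p v * dy p v) := by
    ring_nf at hv h1 ⊢
    linarith
  exact pos_of_mul_pos_right (pos_of_mul_pos_right h2 (by positivity)) (by positivity)

theorem xc_nonneg_of_timelikePrecedes {p q : Mfd d rb rc}
    (hpq : (spacetime h).TimelikePrecedes p q) (hp : 0 ≤ xc p) : 0 ≤ xc q := by
  obtain ⟨a, b, γ, hab, hγ, rfl, rfl⟩ := hpq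
  exact nonneg_of_hasDerivWithinAt_pos_of_eq_zero (f := fun t => xc (γ t)) hab.le
    (fun t ht => hasDerivWithinAt_xc h hγ.1 ht) (fun t ht _ => hγ.2 t ht) hp

/-- Unlike that of `x`, the derivative of `y` is controlled only on `y = 0`; this is why the barrier
lemma asks for its sign only at zeros. -/
theorem yc_nonneg_of_timelikePrecedes {p q : Mfd d rb rc}
    (hpq : (spacetime h).TimelikePrecedes p q) (hp : 0 ≤ yc p) : 0 ≤ yc q := by
  obtain ⟨a, b, γ, hab, hγ, rfl, rfl⟩ := hpq
  exact nonneg_of_hasDerivWithinAt_pos_of_eq_zero (f := fun t => yc (γ t)) hab.le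
    (fun t ht => hasDerivWithinAt_yc h hγ.1 ht)
    (fun t ht h0 => dy_pos_of_yc_eq_zero h (hγ.1.2 t ht) (hγ.2 t ht) h0) hp

theorem not_timelikePrecedes_staticI_staticII {p q : Mfd d rb rc} (hp : p ∈ staticI d rb rc)
    (hq : q ∈ staticII d rb rc) : ¬ (spacetime h).TimelikePrecedes p q :=
  fun hpq => (xc_nonneg_of_timelikePrecedes h hpq hp.1.le).not_gt hq.1

theorem not_timelikePrecedes_staticII_staticI {p q : Mfd d rb rc} (hp : p ∈ staticI d rb rc)
    (hq : q ∈ staticII d rb rc) : ¬ (spacetime h).TimelikePrecedes q p :=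
  fun hqp => (yc_nonneg_of_timelikePrecedes h hqp hq.2.le).not_gt hp.2

end Causality

/-! ### The critical radius -/

section StaticRadius

/-- The radius of the static geodesics: `V` has a positive critical value between the horizons. -/
theorem Params.exists_deriv_V_eq_zero (h : Params d μ l rb rc) :
    ∃ r ∈ Ioo rb rc, 0 < V d μ l r ∧ deriv (V d μ l) r = 0 := by
  have hrc : 0 < rc := h.rb_pos.trans h.rb_lt_rc
  have hcont : ContinuousOn (V d μ l) (Icc rb rc) := fun r hr =>
    (analyticAt_V d μ l (h.rb_pos.trans_le hr.1)).continuousAt.continuousWithinAt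
  obtain ⟨r, hr, hmax⟩ := isCompact_Icc.exists_isMaxOn (nonempty_Icc.2 h.rb_lt_rc.le) hcont
  have hpos : 0 < V d μ l r := by
    by_contra hcon
    -- If the maximum were nonpositive, the left slopes at `rc` would be nonnegative, giving `V'(rc)
    -- ≥ 0` against `κ > 0`.
    have hnonpos : ∀ s ∈ Icc rb rc, V d μ l s ≤ 0 := fun s hs => (hmax hs).trans (not_lt.1 hcon)
    have hd : HasDerivWithinAt (V d μ l) (deriv (V d μ l) rc) (Iio rc) rc :=
      (analyticAt_V d μ l hrc).differentiableAt.hasDerivAt.hasDerivWithinAt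
    have hlim := (hasDerivWithinAt_iff_tendsto_slope' (by simp)).1 hd
    have hge : 0 ≤ deriv (V d μ l) rc := by
      refine ge_of_tendsto hlim ?_
      filter_upwards [Ioo_mem_nhdsLT h.rb_lt_rc] with s hs
      rw [slope_def_field, h.V_rc, sub_zero]
      apply div_nonneg_of_nonpos <;> linarith [hs.2, hnonpos s (Ioo_subset_Icc_self hs)]
    have := h.kappa_pos
    unfold kappa at this
    linarith
  have hr' : r ∈ Ioo rb rc := by
    refine ⟨hr.1.lt_of_ne ?_, hr.2.lt_of_ne ?_⟩
    · rintro rfl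
      exact hpos.ne' h.V_rb
    · rintro rfl
      exact hpos.ne' h.V_rc
  exact ⟨r, hr', hpos, (hmax.isLocalMax (Icc_mem_nhds hr'.1 hr'.2)).deriv_eq_zero⟩

theorem Params.hasDerivAt_W (h : Params d μ l rb rc) {r : ℝ} (hr : 0 < r) :
    HasDerivAt (W d μ l rc) (deriv (W d μ l rc) r) r :=
  (analyticAt_W d μ l (h.rb_pos.trans h.rb_lt_rc) hr).differentiableAt.hasDerivAt

/-- The regular form of the metric contains `W` instead of `V`; this turns the criticality of `V`
into a relation between `W` and `W'`, the form used in the geodesic equation. -/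
theorem Params.deriv_V_eq (h : Params d μ l rb rc) {r : ℝ} (hr : 0 < r) :
    deriv (V d μ l) r = -2 * kappa d μ l rc + 2 * (r - rc) * W d μ l rc r
      + (r - rc) ^ 2 * deriv (W d μ l rc) r := by
  have e : V d μ l = fun r => -2 * kappa d μ l rc * (r - rc) + (r - rc) ^ 2 * W d μ l rc r :=
    funext (V_eq_W h.V_rc)
  have h1 : HasDerivAt (fun r => r - rc) 1 r := (hasDerivAt_id r).sub_const rc
  have h2 := (h1.const_mul (-2 * kappa d μ l rc)).add ((h1.pow 2).mul (h.hasDerivAt_W hr))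
  rw [e]
  refine h2.deriv.trans ?_
  simp
  ring

end StaticRadius

/-! ### Static worldlines as endless timelike geodesics -/

section StaticWorldline

/-- The worldline, parametrized by `κ t`, of a static observer at the radius `rc - a` and at the
angular position `θ`, in the static region where `x` has the sign `σ`. -/
def staticWorldline {a σ : ℝ} (ha : a < rc - rb) (hσ : σ * σ = 1) (θ : Sph d) (t : ℝ) :
    Mfd d rb rc :=
  (⟨(σ * Real.exp t, -(σ * a * Real.exp (-t))), by
    have : Real.exp t * Real.exp (-t) = 1 := by rw [← Real.exp_add]; simp
    have e : rc + σ * Real.exp t * -(σ * a * Real.exp (-t)) = rc - a := by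
      linear_combination -a * Real.exp t * Real.exp (-t) * hσ - a * this
    change rb < rc + σ * Real.exp t * -(σ * a * Real.exp (-t))
    linarith⟩, θ)

variable {a σ : ℝ} (ha : a < rc - rb) (hσ : σ * σ = 1) (θ : Sph d)

theorem xc_staticWorldline (t : ℝ) : xc (staticWorldline ha hσ θ t) = σ * Real.exp t := rfl

theorem yc_staticWorldline (t : ℝ) :
    yc (staticWorldline ha hσ θ t) = -(σ * a * Real.exp (-t)) := rfl

include hσ in
theorem xc_mul_yc_staticWorldline (t : ℝ) :
    σ * Real.exp t * -(σ * a * Real.exp (-t)) = -a := by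
  have : Real.exp t * Real.exp (-t) = 1 := by rw [← Real.exp_add]; simp
  linear_combination -a * Real.exp t * Real.exp (-t) * hσ - a * this

theorem rad_staticWorldline (t : ℝ) : rad (staticWorldline ha hσ θ t) = rc - a := by
  rw [rad, xc_staticWorldline, yc_staticWorldline, xc_mul_yc_staticWorldline hσ]
  ring

theorem contMDiff_staticWorldline :
    ContMDiff 𝓘(ℝ, ℝ) (model d) ∞ (staticWorldline ha hσ θ) := by
  refine ContMDiff.prodMk ?_ contMDiff_const
  rw [← ContMDiff.subtypeVal_comp_iff]
  have : ContDiff ℝ ∞ (fun t : ℝ => (σ * Real.exp t, -(σ * a * Real.exp (-t)))) := by fun_prop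
  exact this.contMDiff

/-- The constant `c` stands for the angular coordinates of `θ` in whichever chart is used; where
only `x` and `y` matter it is taken to be `0`. -/
theorem hasDerivAt_staticWorldline (c : EuclideanSpace ℝ (Fin (d - 1))) (t : ℝ) :
    HasDerivAt (fun t => (((σ * Real.exp t, -(σ * a * Real.exp (-t))), c) :
        (ℝ × ℝ) × EuclideanSpace ℝ (Fin (d - 1))))
      ((σ * Real.exp t, σ * a * Real.exp (-t)), 0) t := by
  have h1 := (Real.hasDerivAt_exp t).const_mul σ
  have h2 : HasDerivAt (fun t => -(σ * a * Real.exp (-t))) (σ * a * Real.exp (-t)) t := by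
    exact (((hasDerivAt_neg t).exp.const_mul (σ * a)).neg).congr_deriv (by ring)
  exact (h1.prodMk h2).prodMk (hasDerivAt_const t c)

theorem isTimelikeCurve_staticWorldline (h : Params d μ l rb rc) (hV : 0 < V d μ l (rc - a)) :
    (spacetime h).IsTimelikeCurve (staticWorldline ha hσ θ) univ := by
  have hs := contMDiff_staticWorldline (rb := rb) (rc := rc) ha hσ θ
  refine ⟨hs.contMDiffOn, fun t _ => ?_⟩
  have hd := (hs t).mdifferentiableAt (by simp) |>.mdifferentiableWithinAt (s := univ)
  set γ := staticWorldline (rb := rb) (rc := rc) ha hσ θ with hγ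
  set v := (spacetime h).velocity γ univ t
  have h1 : HasDerivAt (fun t => xc (γ t)) (dx (γ t) v) t :=
    (hasDerivWithinAt_comp_mvfderiv ((contMDiff_xc _).mdifferentiableAt (by simp)) hd).hasDerivAt
      univ_mem
  have h2 : HasDerivAt (fun t => yc (γ t)) (dy (γ t) v) t :=
    (hasDerivWithinAt_comp_mvfderiv ((contMDiff_yc _).mdifferentiableAt (by simp)) hd).hasDerivAt
      univ_mem
  have h3 : HasDerivAt (fun t => ang (γ t)) (dang (γ t) v) t :=
    (hasDerivWithinAt_comp_mvfderiv ((contMDiff_ang _).mdifferentiableAt (by simp)) hd).hasDerivAt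
      univ_mem
  have h0 := hasDerivAt_staticWorldline (a := a) (σ := σ) (0 : EuclideanSpace ℝ (Fin (d - 1))) t
  have e1 : dx (γ t) v = σ * Real.exp t := h1.unique h0.fst.fst
  have e2 : dy (γ t) v = σ * a * Real.exp (-t) := h2.unique h0.fst.snd
  have e3 : dang (γ t) v = 0 := h3.unique (hasDerivAt_const t (θ : EuclideanSpace ℝ (Fin (d - 1 + 1))))
  change 0 < metric μ l (γ t) v v
  rw [metric_apply, e1, e2, e3, inner_zero_left, hγ, rad_staticWorldline, yc_staticWorldline]
  have hk := h.kappa_pos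
  have hVW := V_eq_W h.V_rc (rc - a)
  set X := σ * Real.exp t
  have hXY : X * (σ * a * Real.exp (-t)) = a := by
    linear_combination -(xc_mul_yc_staticWorldline (a := a) hσ t)
  set Y := σ * a * Real.exp (-t)
  -- Since `X Y = a`, the squared speed is the constant `V / κ²`: the parameter is `κ` times Killing
  -- time, hence proportional to proper time.
  have : (1 / kappa d μ l rc) * (X * Y + Y * X)
      + ((-Y) ^ 2 * W d μ l rc (rc - a) / kappa d μ l rc ^ 2) * (X * X)
      - (rc - a) ^ 2 * 0 = V d μ l (rc - a) / kappa d μ l rc ^ 2 := by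
    rw [hVW]
    field_simp
    linear_combination (2 * kappa d μ l rc + W d μ l rc (rc - a) * (X * Y + a)) * hXY
  rw [this]
  positivity

/-- A limit in `M` would make the continuous functions `x` and `y` converge, but `|x| = e^t`
diverges at the right end and `|y| = a e^{-t}` at the left end. -/
theorem isEndlessTimelikeCurve_staticWorldline (h : Params d μ l rb rc) (ha0 : 0 < a)
    (hV : 0 < V d μ l (rc - a)) :
    (spacetime h).IsEndlessTimelikeCurve (staticWorldline ha hσ θ) univ := by
  have hσ0 : σ ≠ 0 := by
    rintro rfl
    simp at hσ
  refine ⟨univ_nonempty, isOpen_univ, ordConnected_univ,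
    isTimelikeCurve_staticWorldline ha hσ θ h hV, fun p hp => ?_, fun p hp => ?_⟩
  · have hmap : Tendsto (fun t : ℝ => (⟨t, mem_univ t⟩ : (univ : Set ℝ))) atTop atTop :=
      (OrderIso.Set.univ (α := ℝ)).symm.tendsto_atTop
    have h1 : Tendsto (fun t : ℝ => σ * (σ * Real.exp t)) atTop (𝓝 (σ * xc p)) :=
      (((contMDiff_xc.continuous.tendsto p).comp (hp.comp hmap)).const_mul σ)
    simp only [← mul_assoc, hσ, one_mul] at h1
    exact not_tendsto_nhds_of_tendsto_atTop Real.tendsto_exp_atTop _ h1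
  · have hmap : Tendsto (fun t : ℝ => (⟨t, mem_univ t⟩ : (univ : Set ℝ))) atBot atBot :=
      (OrderIso.Set.univ (α := ℝ)).symm.tendsto_atBot
    -- The factor `-(σ / a)` normalizes `y` to `e^{-t}`.
    have h1 : Tendsto (fun t : ℝ => -(σ / a) * -(σ * a * Real.exp (-t))) atBot
        (𝓝 (-(σ / a) * yc p)) :=
      (((contMDiff_yc.continuous.tendsto p).comp (hp.comp hmap)).const_mul _)
    have e : (fun t : ℝ => -(σ / a) * -(σ * a * Real.exp (-t))) = fun t => Real.exp (-t) := by
      funext t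
      field_simp
      linear_combination hσ
    rw [e] at h1
    exact not_tendsto_nhds_of_tendsto_atTop (Real.tendsto_exp_atTop.comp tendsto_neg_atBot_atTop)
      _ h1

theorem isGeodesic_staticWorldline (h : Params d μ l rb rc)
    (hV : deriv (V d μ l) (rc - a) = 0) :
    (spacetime h).IsGeodesic (staticWorldline ha hσ θ) univ := by
  have hs := contMDiff_staticWorldline (rb := rb) (rc := rc) ha hσ θ
  refine ⟨isOpen_univ, hs.contMDiffOn, fun p₀ t _ hsrc w => ?_⟩
  intro x
  have hk := h.kappa_pos
  have hr : 0 < rc - a := by linarith [h.rb_pos]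
  have hx : x = fun t => ((σ * Real.exp t, -(σ * a * Real.exp (-t))),
      extChartAt (𝓡 (d - 1)) p₀.2 θ) := by
    funext t
    simp only [x]
    rw [extChartAt_prod]
    rfl
  have hdx : ∀ t, deriv x t = ((σ * Real.exp t, σ * a * Real.exp (-t)), 0) := fun t => by
    rw [hx]
    exact (hasDerivAt_staticWorldline _ t).deriv
  -- The chart formula for the metric holds only on the target, and differentiating in `t` needs it
  -- at all nearby times.
  have htgt : ∀ᶠ t' in 𝓝 t, x t' ∈ (extChartAt (model d) p₀).target := by
    filter_upwards [hs.continuous.continuousAt.preimage_mem_nhds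
      ((isOpen_extChartAt_source p₀).mem_nhds hsrc)] with t' ht'
    exact (extChartAt (model d) p₀).map_source ht'
  set k := kappa d μ l rc
  set W₀ := W d μ l rc (rc - a)
  set W₁ := deriv (W d μ l rc) (rc - a)
  -- This is `V'(rc - a) = 0`, the only dynamical input.
  have hrel : -2 * k - 2 * a * W₀ + a ^ 2 * W₁ = 0 := by
    have := h.deriv_V_eq hr
    rw [hV] at this
    linear_combination -this
  have hxy : ∀ t, rc + (x t).1.1 * (x t).1.2 = rc - a := fun t => by
    rw [hx]
    linear_combination xc_mul_yc_staticWorldline (a := a) hσ t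
  -- With the velocity frozen and without angular part, the metric varies with position only through
  -- `y² W(rc + x y)`.
  have hright : fderiv ℝ (fun z => (spacetime h).chartMetric p₀ z (deriv x t) (deriv x t)) (x t) w
      = (σ * Real.exp t) ^ 2 / k ^ 2 * (2 * (x t).1.2 * W₀ * w.1.2
        + (x t).1.2 ^ 2 * W₁ * ((x t).1.1 * w.1.2 + (x t).1.2 * w.1.1)) := by
    set u := deriv x t
    have hu : u.2 = 0 := by simp only [u, hdx]
    have hu1 : u.1.1 = σ * Real.exp t := by simp only [u, hdx]
    have hp : HasFDerivAt (fun z : (ℝ × ℝ) × EuclideanSpace ℝ (Fin (d - 1)) => z.1.1)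
        ((ContinuousLinearMap.fst ℝ ℝ ℝ).comp (ContinuousLinearMap.fst ℝ _ _)) (x t) :=
      hasFDerivAt_fst.comp (x t) hasFDerivAt_fst
    have hq : HasFDerivAt (fun z : (ℝ × ℝ) × EuclideanSpace ℝ (Fin (d - 1)) => z.1.2)
        ((ContinuousLinearMap.snd ℝ ℝ ℝ).comp (ContinuousLinearMap.fst ℝ _ _)) (x t) :=
      hasFDerivAt_snd.comp (x t) hasFDerivAt_fst
    have hW : HasDerivAt (W d μ l rc) W₁ (rc + (x t).1.1 * (x t).1.2) := by
      rw [hxy]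
      exact h.hasDerivAt_W hr
    have hG := ((((hq.pow 2).mul (hW.comp_hasFDerivAt (x t) ((hp.mul hq).const_add rc))).mul_const
      (u.1.1 * u.1.1 / k ^ 2)).const_add ((1 / k) * (u.1.1 * u.1.2 + u.1.2 * u.1.1)))
    have hev : (fun z => (spacetime h).chartMetric p₀ z u u) =ᶠ[𝓝 (x t)] fun z =>
        (1 / k) * (u.1.1 * u.1.2 + u.1.2 * u.1.1)
        + (z.1.2 ^ 2 * W d μ l rc (rc + z.1.1 * z.1.2) / k ^ 2) * (u.1.1 * u.1.1) := by
      filter_upwards [(isOpen_extChartAt_target (I := model d) p₀).mem_nhds htgt.self_of_nhds]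
        with z hz
      exact chartMetric_of_snd_eq_zero p₀ h hz u u hu
    rw [(hG.congr_of_eventuallyEq (hev.trans
      (Eventually.of_forall fun z => by simp; ring))).fderiv]
    simp [hxy, hu1]
    ring
  rw [hright]
  -- The momentum paired with `w`; along the curve `x y = -a`, so `y² x` collapses to `-a y`, linear
  -- in `e^{-t}`.
  have hleft : HasDerivAt (fun t' => (1 / k) * (σ * Real.exp t' * w.1.2
      + σ * a * Real.exp (-t') * w.1.1) + (a * W₀ / k ^ 2 * w.1.1) * (σ * a * Real.exp (-t')))
      ((1 / k) * (σ * Real.exp t * w.1.2 - σ * a * Real.exp (-t) * w.1.1)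
        - (a * W₀ / k ^ 2 * w.1.1) * (σ * a * Real.exp (-t))) t := by
    have h1 := (Real.hasDerivAt_exp t).const_mul σ
    have h2 : HasDerivAt (fun t => σ * a * Real.exp (-t)) (-(σ * a * Real.exp (-t))) t := by
      simpa using ((hasDerivAt_neg t).exp).const_mul (σ * a)
    exact ((((h1.mul_const w.1.2).add (h2.mul_const w.1.1)).const_mul (1 / k)).add
      (h2.const_mul (a * W₀ / k ^ 2 * w.1.1))).congr_deriv (by ring)
  refine (hleft.congr_of_eventuallyEq ?_).congr_deriv ?_
  · filter_upwards [htgt] with t' ht'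
    rw [chartMetric_of_snd_eq_zero p₀ h ht' _ _ (by rw [hdx]), hxy, hdx, hx]
    have := xc_mul_yc_staticWorldline (a := a) hσ t'
    simp only
    linear_combination (W₀ / k ^ 2 * w.1.1 * -(σ * a * Real.exp (-t'))) * this
  · rw [hx]
    simp only
    have hXY : (σ * Real.exp t) * (σ * a * Real.exp (-t)) = a := by
      linear_combination -(xc_mul_yc_staticWorldline (a := a) hσ t)
    set X := σ * Real.exp t
    set Y := σ * a * Real.exp (-t)
    -- After `X Y = a` the `W₁` term carries `a²`, and `hrel` trades `a² W₁` for `2 k + 2 a W₀`.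
    have hXY' : X ^ 2 * (2 * -Y * W₀ * w.1.2 + (-Y) ^ 2 * W₁ * (X * w.1.2 + -Y * w.1.1))
        = 2 * (k * X * w.1.2 - (k + a * W₀) * Y * w.1.1) := by
      linear_combination (-2 * X * W₀ * w.1.2 + W₁ * (X * w.1.2 - Y * w.1.1) * (X * Y + a)) * hXY
        + (X * w.1.2 - Y * w.1.1) * hrel
    rw [div_mul_eq_mul_div (X ^ 2), hXY']
    field_simp
    ring

end StaticWorldline

/-- There is an endless timelike geodesic, of constant radius, in the static region where `x` has
the sign `σ`. -/
theorem exists_static_geodesic (h : Params d μ l rb rc) {σ : ℝ} (hσ : σ * σ = 1) :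
    ∃ γ : ℝ → Mfd d rb rc, (spacetime h).IsGeodesic γ univ ∧
      (spacetime h).IsEndlessTimelikeCurve γ univ ∧
      ∀ t, 0 < σ * xc (γ t) ∧ σ * yc (γ t) < 0 := by
  obtain ⟨r, hr, hV, hV'⟩ := h.exists_deriv_V_eq_zero
  obtain ⟨a, rfl⟩ : ∃ a, r = rc - a := ⟨rc - r, by ring⟩
  have ha0 : 0 < a := by linarith [hr.2]
  have ha : a < rc - rb := by linarith [hr.1]
  -- By spherical symmetry any angular position serves.
  have θ : Sph d := ⟨EuclideanSpace.single 0 1, by simp⟩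
  refine ⟨staticWorldline ha hσ θ, isGeodesic_staticWorldline ha hσ θ h hV',
    isEndlessTimelikeCurve_staticWorldline ha hσ θ h ha0 hV, fun t => ?_⟩
  rw [xc_staticWorldline, yc_staticWorldline, mul_neg, mul_assoc σ a, ← mul_assoc σ,
    ← mul_assoc σ σ, hσ, one_mul, one_mul, neg_lt_zero]
  exact ⟨by positivity, by positivity⟩

end SdS

theorem proposition2p8 {d : ℕ} {μ l rb rc : ℝ} (h : SdS.Params d μ l rb rc) :
    ¬ (SdS.spacetime h).FinitePenroseProperty ∧
    (∃ α β : ℝ → SdS.Mfd d rb rc,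
      ((SdS.spacetime h).IsGeodesic α Set.univ ∧
        (SdS.spacetime h).IsEndlessTimelikeCurve α Set.univ ∧
        ∀ t, α t ∈ SdS.staticI d rb rc) ∧
      ((SdS.spacetime h).IsGeodesic β Set.univ ∧
        (SdS.spacetime h).IsEndlessTimelikeCurve β Set.univ ∧
        ∀ t, β t ∈ SdS.staticII d rb rc)) ∧
    (∀ p ∈ SdS.staticI d rb rc, ∀ q ∈ SdS.staticII d rb rc,
      ¬ (SdS.spacetime h).TimelikePrecedes p q ∧
      ¬ (SdS.spacetime h).TimelikePrecedes q p) := by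
  -- The sign `σ` of `x` selects the static region: `1` for I, `-1` for II.
  obtain ⟨α, hα, hα', hαI⟩ := SdS.exists_static_geodesic h (σ := 1) (by norm_num)
  obtain ⟨β, hβ, hβ', hβII⟩ := SdS.exists_static_geodesic h (σ := -1) (by norm_num)
  have hαI' : ∀ t, α t ∈ SdS.staticI d rb rc := fun t => by simpa [SdS.staticI] using hαI t
  have hβII' : ∀ t, β t ∈ SdS.staticII d rb rc := fun t => by simpa [SdS.staticII] using hβII t
  refine ⟨fun hP => ?_, ⟨α, β, ⟨hα, hα', hαI'⟩, ⟨hβ, hβ', hβII'⟩⟩, fun p hp q hq =>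
    ⟨SdS.not_timelikePrecedes_staticI_staticII h hp hq,
      SdS.not_timelikePrecedes_staticII_staticI h hp hq⟩⟩
  obtain ⟨_, ⟨t, _, rfl⟩, _, ⟨t', _, rfl⟩, hpq⟩ := hP α β univ univ hα' hβ'
  exact SdS.not_timelikePrecedes_staticI_staticII h (hαI' t) (hβII' t') hpq
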